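/- For $x,z\in\mathbb{R}^d$ let $\mathrm{dist}(x,z):=\min_{\alpha\in\{\pm1\}}\|x-\alpha z\|_2$, and let $\mathrm{sign}(t)=1$ for $t>0$, $\mathrm{sign}(t)=-1$ for $t<0$ and $\mathrm{sign}(0)=s_0$, where $s_0\in[-1,1]$ is any fixed convention. There are absolute constants $C,c>0$ and, for every $\eta\in[0,1/4]$, constants $\nu_\eta\in(0,1)$ and $\lambda_\eta>0$ depending only on $\eta$, such that the following holds. Let $m\ge Cd$, let $I_{\mathrm{out}}\subset\{1,\dots,m\}$ be an arbitrary fixed set with $|I_{\mathrm{out}}|=\eta m$, and let $a_1,\dots,a_m$ be i.i.d. $\mathrm{Normal}(0,I_d)$ vectors. Then there is an event of probability at least $1-\exp(-cd)$ on which the following is true simultaneously for all $x_\star\in\mathbb{R}^d$, all outlier values $\xi\in\mathbb{R}^m$ (which may depend on the $a_i$), all $s_0\in[-1,1]$ and all sequences $(x_k)_{k\ge0}$ in $\mathbb{R}^d$. Put $b_i=\xi_i$ for $i\in I_{\mathrm{out}}$ and $b_i=|\langle a_i,x_\star\rangle|$ for $i\notin I_{\mathrm{out}}$. (1) Inexact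 Robust-AM. Suppose that $x_\star\ne0$ or $s_0\neq0$, and that for some sequence $(\epsilon_k)_{k\ge0}$ that is bounded, with $\epsilon_{\max}:=\sup_{k\ge 0}\epsilon_k$, $$\sum_{i=1}^m\bigl|\mathrm{sign}(\langle a_i,x_k\rangle)\langle a_i,x_{k+1}\rangle-b_i\bigr|\le\epsilon_k+\min_{x\in\mathbb{R}^d}\sum_{i=1}^m\bigl|\mathrm{sign}(\langle a_i,x_k\rangle)\langle a_i,x\rangle-b_i\bigr|\qquad\text{for all }k\ge0.$$ If $\max\bigl(\mathrm{dist}(x_0,x_\star),\lambda_\eta\epsilon_{\max}\bigr)\le\sin(2/25)\|x_\star\|_2$, then for all $k\ge 0$ $$\mathrm{dist}(x_k,x_\star)\le\nu_\eta^k\,\mathrm{dist}(x_0,x_\star)+\lambda_\eta\epsilon_{\max}.$$ (2) Exact inner solves. If $$x_{k+1}\in\operatorname*{argmin}_{x\in\mathbb{R}^d}\sum_{i=1}^m\bigl|\langle a_i,x\rangle-\mathrm{sign}(\langle a_i,x_k\rangle)\,b_i\bigr|\qquad\text{for all }k\ge0$$ and $\mathrm{dist}(x_0,x_\star)\le\sin(2/25)\|x_\star\|_2$,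 then $\mathrm{dist}(x_k,x_\star)\le\nu_\eta^k\,\mathrm{dist}(x_0,x_\star)$ for all $k\ge0$. -/

import Mathlib

open MeasureTheory ProbabilityTheory

noncomputable section

namespace RobustPhaseRetrieval

/-- The sign function, with the value at the origin left as a parameter `s₀`. -/
def sgn (s₀ t : ℝ) : ℝ := if 0 < t then 1 else if t < 0 then -1 else s₀

/-- The distance up to a global sign, `min_{α ∈ {1, -1}} ‖x - α z‖₂`. -/
def signDist {d : ℕ} (x z : EuclideanSpace ℝ (Fin d)) : ℝ :=
  min ‖x - z‖ ‖x + z‖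

/-- Amplitude measurements of `z` with outliers: the value is `ξ i` if `i` is in the outlier
support `Iout`, and `|⟨a i, z⟩|` otherwise. -/
def meas {d m : ℕ} (a : Fin m → EuclideanSpace ℝ (Fin d)) (z : EuclideanSpace ℝ (Fin d))
    (Iout : Finset (Fin m)) (ξ : Fin m → ℝ) (i : Fin m) : ℝ :=
  if i ∈ Iout then ξ i else |inner ℝ (a i) z|

/-- The objective of the inner least-absolute-deviation problem at the current iterate `w`, in the
form `∑ |sign⟨a i, w⟩ ⟨a i, y⟩ - b i|`. -/
def innerObj {d m : ℕ} (s₀ : ℝ) (a : Fin m → EuclideanSpace ℝ (Fin d)) (b : Fin m → ℝ)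
    (w y : EuclideanSpace ℝ (Fin d)) : ℝ :=
  ∑ i, |sgn s₀ (inner ℝ (a i) w) * inner ℝ (a i) y - b i|

/-- The same objective in the form `∑ |⟨a i, y⟩ - sign⟨a i, w⟩ b i|`. -/
def exactObj {d m : ℕ} (s₀ : ℝ) (a : Fin m → EuclideanSpace ℝ (Fin d)) (b : Fin m → ℝ)
    (w y : EuclideanSpace ℝ (Fin d)) : ℝ :=
  ∑ i, |inner ℝ (a i) y - sgn s₀ (inner ℝ (a i) w) * b i|

/-- `x` is a sequence of inexact Robust-AM iterates with sub-optimality levels `ε`: the iterate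
`x (k + 1)` minimizes the inner objective at `x k` up to the additive error `ε k`. -/
def IsInexactRobustAM {d m : ℕ} (s₀ : ℝ) (a : Fin m → EuclideanSpace ℝ (Fin d)) (b : Fin m → ℝ)
    (ε : ℕ → ℝ) (x : ℕ → EuclideanSpace ℝ (Fin d)) : Prop :=
  ∀ k y, innerObj s₀ a b (x k) (x (k + 1)) ≤ ε k + innerObj s₀ a b (x k) y

/-- `x` is a sequence of Robust-AM iterates with exact inner solves. -/
def IsRobustAM {d m : ℕ} (s₀ : ℝ) (a : Fin m → EuclideanSpace ℝ (Fin d)) (b : Fin m → ℝ)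
    (x : ℕ → EuclideanSpace ℝ (Fin d)) : Prop :=
  ∀ k, IsMinOn (exactObj s₀ a b (x k)) Set.univ (x (k + 1))

end RobustPhaseRetrieval

end

open RobustPhaseRetrieval

namespace RobustPhaseRetrieval

/-! Everything rests on one deterministic property, `IsStable`: for every direction `h`, the inlier
mass of `|⟨a i, h⟩|` exceeds the outlier mass by `m / 100 * ‖h‖`, even after the inliers whose sign
is mismatched are charged to the other side. If `w` is near `z = ±xstar`, correctly signed inliers
have zero residual at `z`, so moving from `z` to `y` costs `|⟨a i, y - z⟩|` on each of them and
gains at most that much elsewhere. Stability then forces `m / 100 * ‖y - z‖ ≤ ε` for any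
`ε`-minimizer `y`. A single step thus lands within `100 * ε` of `±xstar`, exactly on it when `ε =
0`; the geometric factor `1 / 2` is only slack.

Stability holds by a mean computation, a deviation bound and a net. With at most a quarter of
outliers the signed mean is at least `√(2/π) / 2 ≈ 0.399`. A sign mismatch requires `|⟨a, x⟩| ≤ |⟨a,
w - x⟩|`, which has probability below 6% when `w` is within relative distance `2 / 25` of `x`. A
mismatch set depends on `x` and `w`, so its `ℓ¹` mass is bounded through truncation at height 2: at
most twice its cardinality, plus the total excess over 2, which is already subtracted in
`truncatedBalance`. No union over subsets of indices is needed (`isStable_of_net`,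
`measure_not_isStable_le`). -/

/-! ### One-dimensional Gaussian estimates. -/

lemma integral_abs_gaussianReal : ∫ x, |x| ∂(gaussianReal 0 1) = √(2 / Real.pi) := by
  rw [integral_gaussianReal_eq_integral_smul one_ne_zero]
  have h1 : ∀ x : ℝ, gaussianPDFReal 0 1 x • |x|
      = (fun y : ℝ => (√(2 * Real.pi))⁻¹ * (y ^ (1 : ℝ) * Real.exp (-(1 / 2) * y ^ (2 : ℝ)))) |x| := by
    intro x
    simp only [gaussianPDFReal, smul_eq_mul, Real.rpow_one, NNReal.coe_one, mul_one, sub_zero,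
      Real.rpow_two, sq_abs]
    rw [show -x ^ 2 / 2 = -(1 / 2) * x ^ 2 by ring]
    ring
  simp_rw [h1]
  rw [integral_comp_abs (f := fun y : ℝ => (√(2 * Real.pi))⁻¹ *
    (y ^ (1 : ℝ) * Real.exp (-(1 / 2) * y ^ (2 : ℝ)))), integral_const_mul,
    integral_rpow_mul_exp_neg_mul_rpow two_pos (by norm_num) (by norm_num)]
  norm_num
  have := Real.mul_self_sqrt (zero_le_two (α := ℝ))
  field_simp
  linarith

lemma integrable_exp_mul_abs_gaussianReal (t : ℝ) :
    Integrable (fun x : ℝ => Real.exp (t * |x|)) (gaussianReal 0 1) := by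
  have h1 := integrable_exp_mul_gaussianReal (μ := 0) (v := 1) t
  have h2 := integrable_exp_mul_gaussianReal (μ := 0) (v := 1) (-t)
  refine (h1.add h2).mono' (by fun_prop) (ae_of_all _ fun x => ?_)
  simp only [Pi.add_apply, Real.norm_eq_abs, Real.abs_exp]
  rcases abs_cases x with ⟨h, -⟩ | ⟨h, -⟩ <;> rw [h]
  · linarith [Real.exp_pos (-t * x)]
  · rw [mul_neg, ← neg_mul]
    linarith [Real.exp_pos (t * x)]

lemma integral_exp_mul_gaussianReal (t : ℝ) :
    ∫ x, Real.exp (t * x) ∂(gaussianReal 0 1) = Real.exp (t ^ 2 / 2) := by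
  have := congrFun (mgf_fun_id_gaussianReal (μ := 0) (v := 1)) t
  simpa [mgf] using this

lemma integral_exp_mul_abs_gaussianReal_le (t : ℝ) :
    ∫ x, Real.exp (t * |x|) ∂(gaussianReal 0 1) ≤ 2 * Real.exp (t ^ 2 / 2) := by
  have h1 := integrable_exp_mul_gaussianReal (μ := 0) (v := 1) t
  have h2 := integrable_exp_mul_gaussianReal (μ := 0) (v := 1) (-t)
  calc _ ≤ ∫ x, (Real.exp (t * x) + Real.exp (-t * x)) ∂(gaussianReal 0 1) := by
        refine integral_mono (integrable_exp_mul_abs_gaussianReal t) (h1.add h2) fun x => ?_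
        simp only
        rcases abs_cases x with ⟨h, -⟩ | ⟨h, -⟩ <;> rw [h]
        · linarith [Real.exp_pos (-t * x)]
        · rw [mul_neg, ← neg_mul]
          linarith [Real.exp_pos (t * x)]
    _ = _ := by
        rw [integral_add h1 h2, integral_exp_mul_gaussianReal, integral_exp_mul_gaussianReal,
          neg_sq, two_mul]

lemma integrable_abs_gaussianReal : Integrable (fun x : ℝ => |x|) (gaussianReal 0 1) := by
  refine (integrable_exp_mul_abs_gaussianReal 1).mono' (by fun_prop) (ae_of_all _ fun x => ?_)
  rw [Real.norm_eq_abs, abs_abs, one_mul]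
  linarith [Real.add_one_le_exp |x|]

lemma posPart_abs_sub_two_le (x : ℝ) : max (|x| - 2) 0 ≤ Real.exp (-5) / 2 * Real.exp (2 * |x|) := by
  have h : Real.exp (-5) * Real.exp (2 * |x|) = Real.exp (2 * (|x| - 2) - 1) := by
    rw [← Real.exp_add]; ring_nf
  have h2 := Real.add_one_le_exp (2 * (|x| - 2) - 1)
  have h3 := Real.exp_pos (2 * (|x| - 2) - 1)
  refine max_le ?_ (by positivity)
  linarith

lemma integrable_posPart_abs_sub_two_gaussianReal :
    Integrable (fun x : ℝ => max (|x| - 2) 0) (gaussianReal 0 1) :=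
  (integrable_abs_gaussianReal.sub (integrable_const 2)).sup (integrable_const 0)

lemma integral_posPart_abs_sub_two_gaussianReal_le :
    ∫ x, max (|x| - 2) 0 ∂(gaussianReal 0 1) ≤ Real.exp (-3) := by
  calc _ ≤ ∫ x, Real.exp (-5) / 2 * Real.exp (2 * |x|) ∂(gaussianReal 0 1) :=
        integral_mono integrable_posPart_abs_sub_two_gaussianReal
          ((integrable_exp_mul_abs_gaussianReal 2).const_mul _) posPart_abs_sub_two_le
    _ ≤ Real.exp (-5) / 2 * (2 * Real.exp (2 ^ 2 / 2)) := by
        rw [integral_const_mul]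
        gcongr
        exact integral_exp_mul_abs_gaussianReal_le 2
    _ = Real.exp (-3) := by
        rw [div_mul_eq_mul_div, mul_div_assoc, mul_div_cancel_left₀ _ two_ne_zero, ← Real.exp_add]
        norm_num

/-- The density is at most `1 / √(2π)` and the interval has length `2 * y`. -/
lemma gaussianReal_abs_le_le {y : ℝ} (hy : 0 ≤ y) :
    gaussianReal 0 1 {x | |x| ≤ y} ≤ ENNReal.ofReal (√(2 / Real.pi) * y) := by
  have h : {x : ℝ | |x| ≤ y} = Set.Icc (-y) y := by ext x; simp [abs_le]
  rw [gaussianReal_apply_eq_integral _ one_ne_zero, h]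
  refine ENNReal.ofReal_le_ofReal ?_
  calc _ ≤ ∫ x in Set.Icc (-y) y, (√(2 * Real.pi))⁻¹ := by
        refine setIntegral_mono (integrable_gaussianPDFReal _ _).integrableOn
          (integrableOn_const (by simp)) fun x => ?_
        simp only [gaussianPDFReal, NNReal.coe_one, mul_one]
        refine mul_le_of_le_one_right (by positivity) (Real.exp_le_one_iff.2 ?_)
        have := sq_nonneg (x - 0); linarith
    _ = _ := by
        have hpi := Real.mul_self_sqrt (zero_le_two (α := ℝ))
        simp only [integral_const, MeasurableSet.univ, measureReal_restrict_apply, Set.univ_inter,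
          Real.volume_real_Icc, sub_neg_eq_add, smul_eq_mul, Real.sqrt_div zero_le_two,
          Real.sqrt_mul zero_le_two]
        rw [max_eq_left (by linarith)]
        field_simp
        rw [sq, hpi]
        ring

/-! ### Exponential moments and a deviation inequality. -/

lemma exp_le_one_add_add_sq_mul_exp_abs (y : ℝ) :
    Real.exp y ≤ 1 + y + y ^ 2 * Real.exp |y| := by
  have h1 : Real.exp y - 1 ≤ y * Real.exp y := by
    have := mul_le_mul_of_nonneg_left (Real.add_one_le_exp (-y)) (Real.exp_pos y).le
    rw [← Real.exp_add, add_neg_cancel, Real.exp_zero] at this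
    linarith
  rcases le_total 0 y with h | h
  · rw [abs_of_nonneg h]
    nlinarith [mul_le_mul_of_nonneg_left h1 h]
  · rw [abs_of_nonpos h]
    nlinarith [Real.add_one_le_exp y, Real.add_one_le_exp (-y), sq_nonneg y,
      mul_le_mul_of_nonneg_left (Real.add_one_le_exp y) (neg_nonneg.2 h)]

/-- For `t ≤ 1 / 2` half of the exponent `|x|` absorbs the exponential remainder and the other half
absorbs `x ^ 2`, so one exponential moment of `|x|` controls the Laplace transform to second order.
-/
lemma exp_mul_le_of_le_half {t : ℝ} (ht : 0 ≤ t) (ht' : t ≤ 1 / 2) (x : ℝ) :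
    Real.exp (t * x) ≤ 1 + t * x + 8 * t ^ 2 * Real.exp |x| := by
  have h1 := exp_le_one_add_add_sq_mul_exp_abs (t * x)
  have h2 : Real.exp |t * x| ≤ Real.exp (|x| / 2) := by
    rw [abs_mul, abs_of_nonneg ht]
    exact Real.exp_le_exp.2 (by nlinarith [abs_nonneg x])
  have h3 : x ^ 2 ≤ 8 * Real.exp (|x| / 2) := by
    have := Real.quadratic_le_exp_of_nonneg (x := |x| / 2) (by positivity)
    have h4 := sq_abs x
    nlinarith [abs_nonneg x]
  have h5 : Real.exp |x| = Real.exp (|x| / 2) * Real.exp (|x| / 2) := by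
    rw [← Real.exp_add, add_halves]
  have h6 : (t * x) ^ 2 * Real.exp |t * x| ≤ 8 * t ^ 2 * Real.exp |x| := by
    calc (t * x) ^ 2 * Real.exp |t * x| = t ^ 2 * (x ^ 2 * Real.exp |t * x|) := by ring
      _ ≤ t ^ 2 * ((8 * Real.exp (|x| / 2)) * Real.exp (|x| / 2)) := by gcongr
      _ = _ := by rw [h5]; ring
  linarith

section

variable {Ω : Type*} [MeasurableSpace Ω] {P : Measure Ω} [IsProbabilityMeasure P]

lemma mgf_le_of_integral_exp_abs_le {X : Ω → ℝ} (hX : AEMeasurable X P) {B : ℝ}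
    (hint : Integrable (fun ω => Real.exp |X ω|) P) (hB : ∫ ω, Real.exp |X ω| ∂P ≤ B)
    {t : ℝ} (ht : 0 ≤ t) (ht' : t ≤ 1 / 2) :
    Integrable (fun ω => Real.exp (t * X ω)) P ∧
      mgf X P t ≤ Real.exp (t * ∫ ω, X ω ∂P + 8 * t ^ 2 * B) := by
  have hXi : Integrable X P := by
    refine hint.mono' hX.aestronglyMeasurable (ae_of_all _ fun ω => ?_)
    rw [Real.norm_eq_abs]
    linarith [Real.add_one_le_exp |X ω|]
  have hi : Integrable (fun ω => Real.exp (t * X ω)) P := by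
    refine hint.mono' (by fun_prop) (ae_of_all _ fun ω => ?_)
    rw [Real.norm_eq_abs, Real.abs_exp]
    refine Real.exp_le_exp.2 ?_
    have := le_abs_self (X ω)
    nlinarith [abs_nonneg (X ω)]
  refine ⟨hi, ?_⟩
  have h1 : Integrable (fun ω => 1 + t * X ω) P := (integrable_const 1).add (hXi.const_mul t)
  have h2 := hint.const_mul (8 * t ^ 2)
  calc mgf X P t ≤ ∫ ω, (1 + t * X ω + 8 * t ^ 2 * Real.exp |X ω|) ∂P :=
        integral_mono hi (h1.add h2) fun ω => exp_mul_le_of_le_half ht ht' (X ω)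
    _ = 1 + t * ∫ ω, X ω ∂P + 8 * t ^ 2 * ∫ ω, Real.exp |X ω| ∂P := by
        rw [integral_add h1 h2, integral_add (integrable_const 1) (hXi.const_mul t),
          integral_const_mul, integral_const_mul]
        simp
    _ ≤ 1 + t * ∫ ω, X ω ∂P + 8 * t ^ 2 * B := by gcongr
    _ ≤ _ := by
        linarith [Real.add_one_le_exp (t * ∫ ω, X ω ∂P + 8 * t ^ 2 * B)]

/-- The exponential rate in the deviation inequality `measure_sum_ge_le_exp`. -/
noncomputable def deviationRate (B δ : ℝ) : ℝ := min (1 / 2) (δ / (16 * B)) * δ / 2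

lemma deviationRate_pos {B δ : ℝ} (hB : 0 < B) (hδ : 0 < δ) : 0 < deviationRate B δ := by
  unfold deviationRate
  positivity

/-- A Bernstein-type deviation inequality for sums of independent random variables with uniformly
bounded exponential absolute moments. -/
lemma measure_sum_ge_le_exp {m : ℕ} {X : Fin m → Ω → ℝ} (hX : ∀ i, AEMeasurable (X i) P)
    (hind : iIndepFun X P) {B δ : ℝ} (hB : 0 < B) (hδ : 0 < δ)
    (hint : ∀ i, Integrable (fun ω => Real.exp |X i ω|) P)
    (hXB : ∀ i, ∫ ω, Real.exp |X i ω| ∂P ≤ B) {M : ℝ} (hM : ∑ i, ∫ ω, X i ω ∂P + δ * m ≤ M) :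
    P.real {ω | M ≤ ∑ i, X i ω} ≤ Real.exp (-(deviationRate B δ * m)) := by
  -- This `t` makes the quadratic term `8 * t ^ 2 * B` at most half of the linear gain `t * δ`.
  set t := min (1 / 2) (δ / (16 * B)) with ht_def
  have ht : 0 ≤ t := by positivity
  have ht1 : t ≤ 1 / 2 := min_le_left _ _
  have ht2 : t ≤ δ / (16 * B) := min_le_right _ _
  have key := fun i => mgf_le_of_integral_exp_abs_le (hX i) (hint i) (hXB i) ht ht1
  have hsum : Integrable (fun ω => Real.exp (t * (∑ i, X i) ω)) P := by
    -- The variables are only a.e. measurable, so integrability is proved for measurable versions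
    -- and transferred.
    have hY := (hind.congr fun i => (hX i).ae_eq_mk).integrable_exp_mul_sum (t := t)
      (s := Finset.univ) (fun i => (hX i).measurable_mk) fun i _ =>
        (key i).1.congr ((hX i).ae_eq_mk.mono fun ω hω => by simp only [hω])
    refine hY.congr ((ae_all_iff.2 fun i => (hX i).ae_eq_mk).mono fun ω hω => ?_)
    simp only [Finset.sum_apply, hω]
  have h := measure_ge_le_exp_mul_mgf M ht hsum
  simp only [Finset.sum_apply] at h
  refine h.trans ?_
  rw [hind.mgf_sum₀ hX]
  calc Real.exp (-t * M) * ∏ i, mgf (X i) P t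
      ≤ Real.exp (-t * M) * ∏ i, Real.exp (t * ∫ ω, X i ω ∂P + 8 * t ^ 2 * B) := by
        gcongr with i
        · exact fun i _ => mgf_nonneg
        · exact (key i).2
    _ = Real.exp (-t * M + (t * ∑ i, ∫ ω, X i ω ∂P + m * (8 * t ^ 2 * B))) := by
        rw [← Real.exp_sum, ← Real.exp_add, Finset.sum_add_distrib, ← Finset.mul_sum]
        simp
    _ ≤ _ := by
        refine Real.exp_le_exp.2 ?_
        have h1 : t * (16 * B) ≤ δ := (le_div_iff₀ (by positivity)).1 ht2
        have h2 := mul_le_mul_of_nonneg_left hM ht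
        have h3 : t * (t * (16 * B)) * m ≤ t * δ * m := by gcongr
        simp only [deviationRate, ← ht_def]
        nlinarith

end

/-! ### Nets by volume comparison. -/

open Metric Module in
open scoped Function ENNReal in
/-- Volumetric bound on the size of a separated set in the unit ball. -/
lemma card_le_of_isSeparated_of_norm_le_one {E : Type*} [NormedAddCommGroup E] [NormedSpace ℝ E]
    [FiniteDimensional ℝ E] {r : ℝ} (hr : 0 < r) (s : Finset E) (hs : ∀ c ∈ s, ‖c‖ ≤ 1)
    (h : ∀ c ∈ s, ∀ d ∈ s, c ≠ d → r ≤ ‖c - d‖) : (s.card : ℝ) ≤ (1 + 2 / r) ^ finrank ℝ E := by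
  borelize E
  let μ : Measure E := Measure.addHaar
  have hr2 : 0 < r / 2 := by positivity
  have hρ : 0 < 1 + r / 2 := by positivity
  set A := ⋃ c ∈ s, ball (c : E) (r / 2) with hA
  have D : Set.Pairwise (s : Set E) (Disjoint on fun c => ball (c : E) (r / 2)) := by
    rintro c hc d hd hcd
    apply ball_disjoint_ball
    rw [dist_eq_norm, add_halves]
    exact h c hc d hd hcd
  have A_subset : A ⊆ ball (0 : E) (1 + r / 2) := by
    refine Set.iUnion₂_subset fun x hx => ball_subset_ball' ?_
    rw [dist_zero_right, add_comm]
    gcongr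
    exact hs x hx
  have I : (s.card : ℝ≥0∞) * ENNReal.ofReal ((r / 2) ^ finrank ℝ E) * μ (ball 0 1) ≤
      ENNReal.ofReal ((1 + r / 2) ^ finrank ℝ E) * μ (ball 0 1) :=
    calc
      _ = μ A := by
        rw [hA, measure_biUnion_finset D fun c _ => measurableSet_ball]
        simp only [μ.addHaar_ball_of_pos _ hr2, Finset.sum_const, nsmul_eq_mul, mul_assoc]
      _ ≤ μ (ball (0 : E) (1 + r / 2)) := measure_mono A_subset
      _ = _ := by simp only [μ.addHaar_ball_of_pos _ hρ]
  have J := (ENNReal.mul_le_mul_iff_left (measure_ball_pos μ _ zero_lt_one).ne'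
    measure_ball_lt_top.ne).1 I
  have K := ENNReal.toReal_le_of_le_ofReal (pow_nonneg hρ.le _) J
  rw [ENNReal.toReal_mul, ENNReal.toReal_natCast, ENNReal.toReal_ofReal (by positivity),
    ← le_div_iff₀ (by positivity), ← div_pow] at K
  refine K.trans_eq ?_
  congr 1
  field_simp
  ring

/-- Every subset of the unit ball has a net of size exponential in the dimension. -/
lemma exists_finset_net {E : Type*} [NormedAddCommGroup E] [NormedSpace ℝ E]
    [FiniteDimensional ℝ E] {r : ℝ} (hr : 0 < r) (S : Set E) (hS : ∀ x ∈ S, ‖x‖ ≤ 1) :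
    ∃ N : Finset E, (∀ x ∈ N, x ∈ S) ∧ (∀ x ∈ S, ∃ y ∈ N, ‖x - y‖ ≤ r) ∧
      (N.card : ℝ) ≤ (1 + 2 / r) ^ Module.finrank ℝ E := by
  classical
  -- A separated subset of `S` of maximal cardinality is a net with points in `S`; the volumetric
  -- bound ensures that a maximum exists.
  let Q : ℕ → Prop := fun n => ∃ N : Finset E, N.card = n ∧ (∀ x ∈ N, x ∈ S) ∧
    ∀ c ∈ N, ∀ d ∈ N, c ≠ d → r ≤ ‖c - d‖
  have hbound : ∀ n, Q n → n ≤ ⌊(1 + 2 / r) ^ Module.finrank ℝ E⌋₊ := by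
    rintro _ ⟨N, rfl, hN, hsep⟩
    exact Nat.le_floor (card_le_of_isSeparated_of_norm_le_one hr N (fun c hc => hS c (hN c hc)) hsep)
  have hQ0 : Q 0 := ⟨∅, by simp⟩
  obtain ⟨N, hcard, hN, hsep⟩ := Nat.findGreatest_spec (P := Q) (Nat.zero_le
    ⌊(1 + 2 / r) ^ Module.finrank ℝ E⌋₊) hQ0
  refine ⟨N, hN, fun x hx => ?_,
    card_le_of_isSeparated_of_norm_le_one hr N (fun c hc => hS c (hN c hc)) hsep⟩
  by_contra! hfar
  have hxN : x ∉ N := fun hxN => by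
    have := hfar x hxN
    rw [sub_self, norm_zero] at this
    linarith
  have hQ : Q (N.card + 1) := by
    refine ⟨insert x N, Finset.card_insert_of_notMem hxN, ?_, ?_⟩
    · simpa [hx] using hN
    · intro c hc d hd hcd
      rcases Finset.mem_insert.1 hc with rfl | hc' <;> rcases Finset.mem_insert.1 hd with rfl | hd'
      · exact absurd rfl hcd
      · exact (hfar d hd').le
      · rw [norm_sub_rev]; exact (hfar c hc').le
      · exact hsep c hc' d hd' hcd
  have := Nat.le_findGreatest (hbound _ hQ) hQ
  omega

/-! ### Linear functionals of the standard Gaussian vector. -/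

section

variable {d : ℕ}

local notation "𝔼" d => EuclideanSpace ℝ (Fin d)

lemma map_inner_stdGaussian {v : 𝔼 d} (hv : ‖v‖ = 1) :
    (stdGaussian (𝔼 d)).map (fun a => inner ℝ a v) = gaussianReal 0 1 := by
  have h := IsGaussian.map_eq_gaussianReal (μ := stdGaussian (𝔼 d)) (innerSL ℝ v)
  rw [integral_strongDual_stdGaussian, variance_dual_stdGaussian, innerSL_apply_norm, hv] at h
  convert h using 2
  · ext a; simp [real_inner_comm]
  · simp

lemma integral_comp_inner_stdGaussian {v : 𝔼 d} (hv : ‖v‖ = 1) {f : ℝ → ℝ} (hf : Continuous f) :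
    ∫ a, f (inner ℝ a v) ∂(stdGaussian (𝔼 d)) = ∫ t, f t ∂(gaussianReal 0 1) := by
  rw [← map_inner_stdGaussian hv, integral_map (by fun_prop) hf.aestronglyMeasurable]

lemma integrable_comp_inner_stdGaussian {v : 𝔼 d} (hv : ‖v‖ = 1) {f : ℝ → ℝ}
    (hf : Integrable f (gaussianReal 0 1)) :
    Integrable (fun a => f (inner ℝ a v)) (stdGaussian (𝔼 d)) := by
  rw [← map_inner_stdGaussian hv] at hf
  exact hf.comp_aemeasurable (by fun_prop)

lemma integrable_abs_inner_stdGaussian (v : 𝔼 d) :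
    Integrable (fun a => |inner ℝ a v|) (stdGaussian (𝔼 d)) := by
  rcases eq_or_ne v 0 with rfl | hv
  · simp
  · have h := (integrable_comp_inner_stdGaussian (v := ‖v‖⁻¹ • v) (by simp [norm_smul, hv])
      integrable_abs_gaussianReal).const_mul ‖v‖
    refine h.congr (ae_of_all _ fun a => ?_)
    simp only [inner_smul_right, abs_mul, abs_inv, abs_norm]
    field_simp

lemma integral_abs_inner_stdGaussian (v : 𝔼 d) :
    ∫ a, |inner ℝ a v| ∂(stdGaussian (𝔼 d)) = √(2 / Real.pi) * ‖v‖ := by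
  rcases eq_or_ne v 0 with rfl | hv
  · simp
  · have h := integral_comp_inner_stdGaussian (v := ‖v‖⁻¹ • v) (by simp [norm_smul, hv])
      continuous_abs
    rw [integral_abs_gaussianReal] at h
    rw [← h, ← integral_mul_const]
    congr 1
    ext a
    simp only [inner_smul_right, abs_mul, abs_inv, abs_norm]
    field_simp

lemma indepFun_inner_stdGaussian {u v : 𝔼 d} (huv : inner ℝ u v = 0) :
    IndepFun (fun a => inner ℝ a u) (fun a => inner ℝ a v) (stdGaussian (𝔼 d)) := by
  refine HasGaussianLaw.indepFun_of_covariance_eq_zero ?_ ?_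
  · have := (IsGaussian.hasGaussianLaw_id (μ := stdGaussian (𝔼 d))).map
      ((innerSL ℝ u).prod (innerSL ℝ v))
    refine this.congr (ae_of_all _ fun a => ?_)
    simp [real_inner_comm]
  · have h := covarianceBilin_apply_eq_cov (μ := stdGaussian (𝔼 d)) IsGaussian.memLp_two_id u v
    rw [covarianceBilin_stdGaussian] at h
    simp only [real_inner_comm] at h ⊢
    rw [← h]
    rw [innerSL_apply_apply, huv]

lemma sqrt_two_div_pi_lt : √(2 / Real.pi) < 0.7979 := by
  rw [Real.sqrt_lt' (by norm_num), div_lt_iff₀ Real.pi_pos]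
  nlinarith [Real.pi_gt_d6]

lemma lt_sqrt_two_div_pi : 0.7978 < √(2 / Real.pi) := by
  rw [Real.lt_sqrt (by norm_num), lt_div_iff₀ Real.pi_pos]
  nlinarith [Real.pi_lt_d6]

lemma exp_neg_three_lt : Real.exp (-3) < 0.0498 := by
  rw [Real.exp_neg, show (3 : ℝ) = (3 : ℕ) * 1 by norm_num, Real.exp_nat_mul,
    inv_lt_comm₀ (by positivity) (by norm_num)]
  have h := Real.exp_one_gt_d9
  calc (0.0498 : ℝ)⁻¹ < 2.7182818283 ^ 3 := by norm_num
    _ ≤ _ := by gcongr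

/-- A Gaussian vector rarely has a coordinate along `x` that is dominated by its component along a
short vector `u`. -/
lemma stdGaussian_abs_inner_le_add_le {x u : 𝔼 d} (hx : ‖x‖ = 1) (hu : ‖u‖ ≤ 2 / 25) :
    (stdGaussian (𝔼 d)).real {a | |inner ℝ a x| ≤ |inner ℝ a u| + 0.004} ≤ 0.059 := by
  set μ := stdGaussian (𝔼 d)
  -- Splitting `u` along `x` and its orthogonal complement makes the two Gaussian coordinates
  -- independent. The part along `x` is absorbed on the left, leaving the factor `0.92 = 1 - 2 /
  -- 25`.
  set α : ℝ := inner ℝ x u with hα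
  set y := u - α • x with hy
  have hxy : inner ℝ x y = 0 := by
    rw [hy, inner_sub_right, inner_smul_right, real_inner_self_eq_norm_sq, hx]; simp [hα]
  have hαle : |α| ≤ 2 / 25 := by
    have := abs_real_inner_le_norm x u
    rw [hx, one_mul] at this
    exact this.trans hu
  have hyle : ‖y‖ ≤ 2 / 25 := by
    refine le_trans ?_ hu
    have h1 : u = α • x + y := by rw [hy]; abel
    have h2 := norm_add_sq_eq_norm_sq_add_norm_sq_real (x := α • x) (y := y)
      (by rw [inner_smul_left, hxy, mul_zero])
    rw [← h1] at h2
    exact (sq_le_sq₀ (norm_nonneg _) (norm_nonneg _)).1 (by nlinarith [sq_nonneg ‖α • x‖])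
  let T : ℝ → ℝ := fun q => (|q| + 0.004) / 0.92
  have hT : ∀ q, 0 ≤ T q := fun q => by positivity
  have hTm : Measurable T := by fun_prop
  let W : Set (ℝ × ℝ) := {p | |p.1| ≤ T p.2}
  have hW : MeasurableSet W := measurableSet_le (by fun_prop) (by fun_prop)
  have hsub : {a : 𝔼 d | |inner ℝ a x| ≤ |inner ℝ a u| + 0.004} ⊆
      (fun a => (inner ℝ a x, inner ℝ a y)) ⁻¹' W := by
    intro a ha
    simp only [Set.mem_ofPred_eq] at ha
    have h1 : inner ℝ a u = α * inner ℝ a x + inner ℝ a y := by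
      rw [hy, inner_sub_right, inner_smul_right]; ring
    have h2 : |inner ℝ a u| ≤ 2 / 25 * |inner ℝ a x| + |inner ℝ a y| := by
      rw [h1]
      refine (abs_add_le _ _).trans ?_
      rw [abs_mul]
      gcongr
    change |inner ℝ a x| ≤ (|inner ℝ a y| + 0.004) / 0.92
    rw [le_div_iff₀ (by norm_num)]
    linarith
  have hmap : μ.map (fun a => (inner ℝ a x, inner ℝ a y)) =
      (gaussianReal 0 1).prod (μ.map fun a => inner ℝ a y) := by
    rw [← map_inner_stdGaussian hx]
    exact (indepFun_iff_map_prod_eq_prod_map_map (by fun_prop) (by fun_prop)).1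
      (indepFun_inner_stdGaussian hxy)
  have hInt : Integrable (fun a => √(2 / Real.pi) * T (inner ℝ a y)) μ :=
    (((integrable_abs_inner_stdGaussian y).add (integrable_const _)).div_const _).const_mul _
  have hle : μ {a | |inner ℝ a x| ≤ |inner ℝ a u| + 0.004} ≤ ENNReal.ofReal 0.059 := by
    -- Given `⟨a, y⟩`, the small-ball bound applies to the independent coordinate `⟨a, x⟩`; the mean
    -- of `|⟨a, y⟩|` then finishes.
    calc μ {a | |inner ℝ a x| ≤ |inner ℝ a u| + 0.004}
        ≤ μ ((fun a => (inner ℝ a x, inner ℝ a y)) ⁻¹' W) := measure_mono hsub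
      _ = ((gaussianReal 0 1).prod (μ.map fun a => inner ℝ a y)) W := by
          rw [← hmap, Measure.map_apply (by fun_prop) hW]
      _ = ∫⁻ q, gaussianReal 0 1 {p | |p| ≤ T q} ∂(μ.map fun a => inner ℝ a y) := by
          rw [Measure.prod_apply_symm hW]; rfl
      _ ≤ ∫⁻ q, ENNReal.ofReal (√(2 / Real.pi) * T q) ∂(μ.map fun a => inner ℝ a y) :=
          lintegral_mono fun q => gaussianReal_abs_le_le (hT q)
      _ = ∫⁻ a, ENNReal.ofReal (√(2 / Real.pi) * T (inner ℝ a y)) ∂μ := by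
          rw [lintegral_map (by fun_prop) (by fun_prop)]
      _ = ENNReal.ofReal (∫ a, √(2 / Real.pi) * T (inner ℝ a y) ∂μ) := by
          rw [ofReal_integral_eq_lintegral_ofReal hInt
            (ae_of_all _ fun a => mul_nonneg (Real.sqrt_nonneg _) (hT _))]
      _ ≤ ENNReal.ofReal 0.059 := by
          refine ENNReal.ofReal_le_ofReal ?_
          rw [integral_const_mul, integral_div, integral_add (integrable_abs_inner_stdGaussian y)
            (integrable_const _), integral_abs_inner_stdGaussian]
          have h1 := sqrt_two_div_pi_lt
          have h2 := Real.sqrt_nonneg (2 / Real.pi)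
          simp only [integral_const, probReal_univ, smul_eq_mul, one_mul]
          calc √(2 / Real.pi) * ((√(2 / Real.pi) * ‖y‖ + 0.004) / 0.92)
              ≤ 0.7979 * ((0.7979 * (2 / 25) + 0.004) / 0.92) := by gcongr
            _ ≤ _ := by norm_num
  rw [Measure.real]
  exact ENNReal.toReal_le_of_le_ofReal (by norm_num) hle

end

/-! ### Deterministic passage from nets to stability. -/

/-- The sign `-1` on the outlier support and `1` off it. -/
noncomputable def outSign {m : ℕ} (Iout : Finset (Fin m)) (i : Fin m) : ℝ := if i ∈ Iout then -1 else 1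

lemma abs_outSign {m : ℕ} (Iout : Finset (Fin m)) (i : Fin m) : |outSign Iout i| = 1 := by
  unfold outSign; split_ifs <;> simp

/-- The contribution of a coefficient `t`, with sign `s`, to the truncated `ℓ¹` balance between
inliers and outliers. -/
noncomputable def truncatedBalance (s t : ℝ) : ℝ := s * |t| - 2 * max (|t| - 2) 0

lemma abs_truncatedBalance_sub_le {s : ℝ} (hs : |s| = 1) (t u : ℝ) :
    |truncatedBalance s t - truncatedBalance s u| ≤ 3 * |t - u| := by
  have h1 : |s * |t| - s * (|u|)| ≤ |t - u| := by
    rw [← mul_sub, abs_mul, hs, one_mul]; exact abs_abs_sub_abs_le _ _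
  have h2 : |max (|t| - 2) 0 - max (|u| - 2) 0| ≤ |t - u| := by
    refine (abs_max_sub_max_le_abs _ _ _).trans ?_
    rw [sub_sub_sub_cancel_right]
    exact abs_abs_sub_abs_le _ _
  unfold truncatedBalance
  rw [abs_le] at *
  constructor <;> linarith

section

variable {d m : ℕ} {a : Fin m → EuclideanSpace ℝ (Fin d)} {N : Finset (EuclideanSpace ℝ (Fin d))}

/-- Control of the `ℓ¹` norm of the coefficients on a net gives control everywhere. -/
lemma sum_abs_inner_le_of_net (hN : ∀ x : EuclideanSpace ℝ (Fin d), ‖x‖ = 1 →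
      ∃ y ∈ N, ‖x - y‖ ≤ 1 / 1000000)
    (hsum : ∀ v ∈ N, ∑ i, |inner ℝ (a i) v| ≤ 0.9 * m) (h : EuclideanSpace ℝ (Fin d)) :
    ∑ i, |inner ℝ (a i) h| ≤ 2 * m * ‖h‖ := by
  have hscale : ∀ M : ℝ, (∀ v : EuclideanSpace ℝ (Fin d), ‖v‖ = 1 → ∑ i, |inner ℝ (a i) v| ≤ M) →
      ∀ v, ∑ i, |inner ℝ (a i) v| ≤ M * ‖v‖ := by
    intro M hM v
    rcases eq_or_ne v 0 with rfl | hv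
    · simp
    · have := hM (‖v‖⁻¹ • v) (by simp [norm_smul, hv])
      simp only [inner_smul_right, abs_mul, abs_inv, abs_norm, ← Finset.mul_sum] at this
      rwa [inv_mul_le_iff₀ (norm_pos_iff.2 hv), mul_comm] at this
  rcases eq_or_ne h 0 with rfl | hh
  · simp
  -- Self-bounding: the maximum `M` over the sphere satisfies `M ≤ 0.9 * m + M / 1000000`.
  obtain ⟨x₀, hx₀, hmax⟩ := (isCompact_sphere (0 : EuclideanSpace ℝ (Fin d)) 1).exists_isMaxOn
    ⟨‖h‖⁻¹ • h, by simp [norm_smul, hh]⟩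
    (f := fun v => ∑ i, |inner ℝ (a i) v|) (by fun_prop)
  have hx₀' : ‖x₀‖ = 1 := by simpa using hx₀
  have hM := hscale (∑ i, |inner ℝ (a i) x₀|) fun v hv => hmax (by simpa using hv)
  obtain ⟨y, hy, hxy⟩ := hN x₀ hx₀'
  have h1 : ∑ i, |inner ℝ (a i) x₀| ≤ ∑ i, |inner ℝ (a i) y| + ∑ i, |inner ℝ (a i) (x₀ - y)| := by
    rw [← Finset.sum_add_distrib]
    refine Finset.sum_le_sum fun i _ => ?_
    rw [inner_sub_right]
    linarith [abs_sub_abs_le_abs_sub (inner ℝ (a i) x₀) (inner ℝ (a i) y)]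
  have h0 : 0 ≤ ∑ i, |inner ℝ (a i) x₀| := Finset.sum_nonneg fun i _ => abs_nonneg _
  have h2 : ∑ i, |inner ℝ (a i) (x₀ - y)| ≤ (∑ i, |inner ℝ (a i) x₀|) * (1 / 1000000) :=
    (hM _).trans (by gcongr)
  have h3 := hsum y hy
  refine hscale _ (fun v hv => (hmax (by simpa using hv)).trans ?_) h
  change ∑ i, |inner ℝ (a i) x₀| ≤ 2 * m
  have : (0 : ℝ) ≤ m := m.cast_nonneg
  linarith

/-- `truncatedBalance` is 3-Lipschitz, so rounding to the net costs at most `3 * (2 * m) / 1000000`.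
-/
lemma truncatedBalance_ge_of_net {s : Fin m → ℝ} (hs : ∀ i, |s i| = 1)
    (hN : ∀ x : EuclideanSpace ℝ (Fin d), ‖x‖ = 1 → ∃ y ∈ N, ‖x - y‖ ≤ 1 / 1000000)
    (hsum : ∀ h : EuclideanSpace ℝ (Fin d), ∑ i, |inner ℝ (a i) h| ≤ 2 * m * ‖h‖)
    (hbal : ∀ v ∈ N, 0.294 * m ≤ ∑ i, truncatedBalance (s i) (inner ℝ (a i) v))
    {h : EuclideanSpace ℝ (Fin d)} (hh : ‖h‖ = 1) :
    0.29 * m ≤ ∑ i, truncatedBalance (s i) (inner ℝ (a i) h) := by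
  obtain ⟨y, hy, hxy⟩ := hN h hh
  have h1 : ∑ i, truncatedBalance (s i) (inner ℝ (a i) y) ≤
      ∑ i, truncatedBalance (s i) (inner ℝ (a i) h) + ∑ i, 3 * |inner ℝ (a i) (h - y)| := by
    rw [← Finset.sum_add_distrib]
    refine Finset.sum_le_sum fun i _ => ?_
    rw [inner_sub_right]
    have := abs_le.1 (abs_truncatedBalance_sub_le (hs i) (inner ℝ (a i) h) (inner ℝ (a i) y))
    linarith
  rw [← Finset.mul_sum] at h1
  have h2 : ∑ i, |inner ℝ (a i) (h - y)| ≤ 2 * m * (1 / 1000000) := (hsum _).trans (by gcongr)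
  have : (0 : ℝ) ≤ m := m.cast_nonneg
  linarith [hbal y hy]

lemma card_filter_lt_abs_inner_le
    (hsum : ∀ h : EuclideanSpace ℝ (Fin d), ∑ i, |inner ℝ (a i) h| ≤ 2 * m * ‖h‖)
    {v : EuclideanSpace ℝ (Fin d)} (hv : ‖v‖ ≤ 1 / 1000000) :
    ((Finset.univ.filter fun i => 0.002 < |inner ℝ (a i) v|).card : ℝ) ≤ 0.001 * m := by
  have h1 : ((Finset.univ.filter fun i => 0.002 < |inner ℝ (a i) v|).card : ℝ) * 0.002 ≤
      ∑ i, |inner ℝ (a i) v| := by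
    rw [← nsmul_eq_mul]
    exact (Finset.card_nsmul_le_sum _ _ _ fun i hi => (Finset.mem_filter.1 hi).2.le).trans
      (Finset.sum_le_sum_of_subset_of_nonneg (Finset.filter_subset _ _)
        fun i _ _ => abs_nonneg _)
  have h2 : ∑ i, |inner ℝ (a i) v| ≤ 2 * m * (1 / 1000000) := (hsum _).trans (by gcongr)
  linarith

/-- The slack `0.004` pays for rounding `x` and `u` by `0.002` each; Markov's inequality bounds the
exceptional indices by `0.001 * m` per rounding. -/
lemma card_filter_abs_inner_le_of_net {U : Finset (EuclideanSpace ℝ (Fin d))}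
    (hN : ∀ x : EuclideanSpace ℝ (Fin d), ‖x‖ = 1 → ∃ y ∈ N, ‖x - y‖ ≤ 1 / 1000000)
    (hU : ∀ u : EuclideanSpace ℝ (Fin d), ‖u‖ ≤ 2 / 25 → ∃ y ∈ U, ‖u - y‖ ≤ 1 / 1000000)
    (hsum : ∀ h : EuclideanSpace ℝ (Fin d), ∑ i, |inner ℝ (a i) h| ≤ 2 * m * ‖h‖)
    (hcard : ∀ x ∈ N, ∀ u ∈ U, ((Finset.univ.filter fun i =>
      |inner ℝ (a i) x| ≤ |inner ℝ (a i) u| + 0.004).card : ℝ) ≤ 0.064 * m)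
    {x u : EuclideanSpace ℝ (Fin d)} (hx : ‖x‖ = 1) (hu : ‖u‖ ≤ 2 / 25) :
    ((Finset.univ.filter fun i => |inner ℝ (a i) x| ≤ |inner ℝ (a i) u|).card : ℝ) ≤
      0.07 * m := by
  obtain ⟨x', hx', hxx'⟩ := hN x hx
  obtain ⟨u', hu', huu'⟩ := hU u hu
  have hsub : (Finset.univ.filter fun i => |inner ℝ (a i) x| ≤ |inner ℝ (a i) u|) ⊆
      (Finset.univ.filter fun i => |inner ℝ (a i) x'| ≤ |inner ℝ (a i) u'| + 0.004) ∪
      ((Finset.univ.filter fun i => 0.002 < |inner ℝ (a i) (x - x')|) ∪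
        (Finset.univ.filter fun i => 0.002 < |inner ℝ (a i) (u - u')|)) := by
    intro i hi
    simp only [Finset.mem_union, Finset.mem_filter, Finset.mem_univ, true_and,
      inner_sub_right] at hi ⊢
    by_contra! hcon
    obtain ⟨h1, h2, h3⟩ := hcon
    have h4 := abs_sub_abs_le_abs_sub (inner ℝ (a i) x') (inner ℝ (a i) x)
    have h5 := abs_sub_abs_le_abs_sub (inner ℝ (a i) u) (inner ℝ (a i) u')
    rw [abs_sub_comm] at h4
    linarith
  have h1 := (Finset.card_le_card hsub).trans ((Finset.card_union_le _ _).trans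
    (Nat.add_le_add_left (Finset.card_union_le _ _) _))
  have h2 : ((Finset.univ.filter fun i => |inner ℝ (a i) x| ≤ |inner ℝ (a i) u|).card : ℝ) ≤ _ :=
    Nat.cast_le.2 h1
  push_cast at h2
  have h3 := hcard x' hx' u' hu'
  have h4 := card_filter_lt_abs_inner_le hsum hxx'
  have h5 := card_filter_lt_abs_inner_le hsum huu'
  have : (0 : ℝ) ≤ m := m.cast_nonneg
  linarith

/-- The indices at which `w` and `x` do not have the same strict sign of measurement. -/
noncomputable def mismatch (a : Fin m → EuclideanSpace ℝ (Fin d)) (w x : EuclideanSpace ℝ (Fin d)) :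
    Finset (Fin m) :=
  Finset.univ.filter fun i => inner ℝ (a i) w * inner ℝ (a i) x ≤ 0

/-- Inliers dominate outliers in `ℓ¹` with a margin, and keep doing so when the inliers whose sign
is mismatched by a nearby vector count as outliers. -/
structure IsStable (a : Fin m → EuclideanSpace ℝ (Fin d)) (Iout : Finset (Fin m)) : Prop where
  balance : ∀ h, m / 100 * ‖h‖ ≤ ∑ i, outSign Iout i * |inner ℝ (a i) h|
  balance_mismatch : ∀ x w h, x ≠ 0 → ‖w - x‖ ≤ 2 / 25 * ‖x‖ →
    m / 100 * ‖h‖ + 2 * ∑ i ∈ mismatch a w x, |inner ℝ (a i) h| ≤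
      ∑ i, outSign Iout i * |inner ℝ (a i) h|

lemma card_mismatch_le
    (hcard : ∀ x u : EuclideanSpace ℝ (Fin d), ‖x‖ = 1 → ‖u‖ ≤ 2 / 25 →
      ((Finset.univ.filter fun i => |inner ℝ (a i) x| ≤ |inner ℝ (a i) u|).card : ℝ) ≤ 0.07 * m)
    {x w : EuclideanSpace ℝ (Fin d)} (hx : x ≠ 0) (hw : ‖w - x‖ ≤ 2 / 25 * ‖x‖) :
    ((mismatch a w x).card : ℝ) ≤ 0.07 * m := by
  have hx' := norm_pos_iff.2 hx
  have h1 : ‖‖x‖⁻¹ • (w - x)‖ ≤ 2 / 25 := by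
    rw [norm_smul, norm_inv, norm_norm, inv_mul_le_iff₀ hx']
    linarith
  refine le_trans (Nat.cast_le.2 (Finset.card_le_card fun i hi => ?_))
    (hcard (‖x‖⁻¹ • x) _ (by simp [norm_smul, hx]) h1)
  simp only [mismatch, Finset.mem_filter, Finset.mem_univ, true_and] at hi ⊢
  rw [inner_smul_right, inner_smul_right, abs_mul, abs_mul, inner_sub_right]
  refine mul_le_mul_of_nonneg_left ?_ (abs_nonneg _)
  -- Opposite signs make the cross term in `(⟨a i, w⟩ - ⟨a i, x⟩) ^ 2` nonnegative.
  refine sq_le_sq.1 ?_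
  nlinarith [sq_nonneg (inner ℝ (a i) w)]

lemma isStable_of_net {Iout : Finset (Fin m)} {U : Finset (EuclideanSpace ℝ (Fin d))}
    (hN : ∀ x : EuclideanSpace ℝ (Fin d), ‖x‖ = 1 → ∃ y ∈ N, ‖x - y‖ ≤ 1 / 1000000)
    (hU : ∀ u : EuclideanSpace ℝ (Fin d), ‖u‖ ≤ 2 / 25 → ∃ y ∈ U, ‖u - y‖ ≤ 1 / 1000000)
    (hsum : ∀ v ∈ N, ∑ i, |inner ℝ (a i) v| ≤ 0.9 * m)
    (hbal : ∀ v ∈ N, 0.294 * m ≤ ∑ i, truncatedBalance (outSign Iout i) (inner ℝ (a i) v))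
    (hcard : ∀ x ∈ N, ∀ u ∈ U, ((Finset.univ.filter fun i =>
      |inner ℝ (a i) x| ≤ |inner ℝ (a i) u| + 0.004).card : ℝ) ≤ 0.064 * m) :
    IsStable a Iout := by
  have hsum' := sum_abs_inner_le_of_net hN hsum
  have hbal' := fun h => truncatedBalance_ge_of_net (h := h) (abs_outSign Iout) hN hsum' hbal
  have hcard' := fun x u => card_filter_abs_inner_le_of_net (x := x) (u := u) hN hU hsum' hcard
  have hm : (0 : ℝ) ≤ m := m.cast_nonneg
  have key : ∀ B : Finset (Fin m), (B.card : ℝ) ≤ 0.07 * m → ∀ h : EuclideanSpace ℝ (Fin d),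
      m / 100 * ‖h‖ + 2 * ∑ i ∈ B, |inner ℝ (a i) h| ≤
        ∑ i, outSign Iout i * |inner ℝ (a i) h| := by
    intro B hB
    have hunit : ∀ h : EuclideanSpace ℝ (Fin d), ‖h‖ = 1 →
        m / 100 + 2 * ∑ i ∈ B, |inner ℝ (a i) h| ≤ ∑ i, outSign Iout i * |inner ℝ (a i) h| := by
      intro h hh
      have h1 := hbal' h hh
      simp only [truncatedBalance, Finset.sum_sub_distrib, ← Finset.mul_sum] at h1
      -- Doubled, the term `B.card * 2` is at most `0.28 * m`; against the balance `0.29 * m` this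
      -- leaves `m / 100`.
      have h2 : ∑ i ∈ B, |inner ℝ (a i) h| ≤
          ∑ i, max (|inner ℝ (a i) h| - 2) 0 + B.card * 2 := by
        calc ∑ i ∈ B, |inner ℝ (a i) h| ≤ ∑ i ∈ B, (max (|inner ℝ (a i) h| - 2) 0 + 2) :=
              Finset.sum_le_sum fun i _ => by
                linarith [le_max_left (|inner ℝ (a i) h| - 2) 0]
          _ = ∑ i ∈ B, max (|inner ℝ (a i) h| - 2) 0 + B.card * 2 := by
              rw [Finset.sum_add_distrib, Finset.sum_const, nsmul_eq_mul]
          _ ≤ _ := by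
              gcongr
              exact Finset.subset_univ _
      linarith
    intro h
    rcases eq_or_ne h 0 with rfl | hh
    · simp
    · have h1 := hunit (‖h‖⁻¹ • h) (by simp [norm_smul, hh])
      have hpos := norm_pos_iff.2 hh
      simp only [inner_smul_right, abs_mul, abs_inv, abs_norm, mul_left_comm _ ‖h‖⁻¹,
        ← Finset.mul_sum] at h1
      have h2 := mul_le_mul_of_nonneg_left h1 hpos.le
      rwa [mul_add, mul_inv_cancel_left₀ hpos.ne', mul_inv_cancel_left₀ hpos.ne', mul_comm] at h2
  constructor
  · intro h
    simpa using key ∅ (by rw [Finset.card_empty, Nat.cast_zero]; positivity) h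
  · intro x w h hx hw
    exact key _ (card_mismatch_le hcard' hx hw) h

end

/-! ### One step of the inner minimization. -/

lemma abs_sgn_le_one {s₀ : ℝ} (hs₀ : s₀ ∈ Set.Icc (-1 : ℝ) 1) (t : ℝ) : |sgn s₀ t| ≤ 1 := by
  unfold sgn
  split_ifs
  · simp
  · simp
  · exact abs_le.2 hs₀

lemma abs_sgn_eq_one {t : ℝ} (s₀ : ℝ) (ht : t ≠ 0) : |sgn s₀ t| = 1 := by
  unfold sgn
  split_ifs with h1 h2
  · simp
  · simp
  · exact absurd (le_antisymm (not_lt.1 h1) (not_lt.1 h2)) ht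

lemma sgn_mul_eq_abs {s₀ t u : ℝ} (h : 0 < t * u) : sgn s₀ t * u = |u| := by
  unfold sgn
  rcases pos_and_pos_or_neg_and_neg_of_mul_pos h with ⟨ht, hu⟩ | ⟨ht, hu⟩
  · rw [if_pos ht, abs_of_pos hu, one_mul]
  · rw [if_neg ht.not_gt, if_pos ht, abs_of_neg hu, neg_one_mul]

lemma sgn_mul_abs_eq {s₀ t u : ℝ} (h : 0 < t * u) : sgn s₀ t * |u| = u := by
  have ht : t ≠ 0 := by rintro rfl; simp at h
  rw [← sgn_mul_eq_abs (s₀ := s₀) h, ← mul_assoc, ← abs_mul_abs_self, abs_sgn_eq_one s₀ ht]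
  simp

section

variable {d m : ℕ} {a : Fin m → EuclideanSpace ℝ (Fin d)} {Iout : Finset (Fin m)}

/-- `F` and `G` stand for the residuals at `y` and `z`, which treats both forms of the objective at
once. A mismatched index may lose `|⟨a i, y - z⟩|` where the signed sum counts a gain, hence the
factor 2. -/
lemma IsStable.norm_sub_le_of_sum_le (ha : IsStable a Iout) {w y z : EuclideanSpace ℝ (Fin d)}
    (hz : z ≠ 0) (hw : ‖w - z‖ ≤ 2 / 25 * ‖z‖) {F G : Fin m → ℝ} {ε : ℝ}
    (hgood : ∀ i ∉ Iout, i ∉ mismatch a w z → |inner ℝ (a i) (y - z)| ≤ F i - G i)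
    (hbad : ∀ i, -|inner ℝ (a i) (y - z)| ≤ F i - G i) (hsum : ∑ i, F i ≤ ε + ∑ i, G i) :
    m / 100 * ‖y - z‖ ≤ ε := by
  have h1 := ha.balance_mismatch z w (y - z) hz hw
  have h2 : ∑ i, outSign Iout i * |inner ℝ (a i) (y - z)| ≤
      ∑ i, (F i - G i) + 2 * ∑ i ∈ mismatch a w z, |inner ℝ (a i) (y - z)| := by
    rw [Finset.mul_sum, ← Finset.sum_filter_add_sum_filter_not Finset.univ (· ∈ mismatch a w z)
      (fun i => outSign Iout i * |inner ℝ (a i) (y - z)|),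
      ← Finset.sum_filter_add_sum_filter_not Finset.univ (· ∈ mismatch a w z)
      (fun i => F i - G i), Finset.filter_univ_mem, add_right_comm, ← Finset.sum_add_distrib]
    refine add_le_add (Finset.sum_le_sum fun i _ => ?_) (Finset.sum_le_sum fun i hi => ?_)
    · have h3 := hbad i
      have h4 : outSign Iout i * |inner ℝ (a i) (y - z)| ≤ |inner ℝ (a i) (y - z)| :=
        mul_le_of_le_one_left (abs_nonneg _) ((le_abs_self _).trans (abs_outSign Iout i).le)
      linarith
    · have h3 := (Finset.mem_filter.1 hi).2
      unfold outSign
      split_ifs with hio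
      · rw [neg_one_mul]; exact hbad i
      · rw [one_mul]; exact hgood i hio h3
  rw [Finset.sum_sub_distrib] at h2
  linarith

lemma meas_eq_of_notMem {xstar z : EuclideanSpace ℝ (Fin d)} (hz : z = xstar ∨ z = -xstar)
    {ξ : Fin m → ℝ} {i : Fin m} (hi : i ∉ Iout) :
    meas a xstar Iout ξ i = |inner ℝ (a i) z| := by
  rw [meas, if_neg hi]
  rcases hz with rfl | rfl
  · rfl
  · rw [inner_neg_right, abs_neg]

lemma IsStable.norm_sub_le_of_innerObj_le (ha : IsStable a Iout)
    {w y z xstar : EuclideanSpace ℝ (Fin d)} (hz : z = xstar ∨ z = -xstar) (hz0 : z ≠ 0)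
    (hw : ‖w - z‖ ≤ 2 / 25 * ‖z‖) {ξ : Fin m → ℝ} {s₀ ε : ℝ} (hs₀ : s₀ ∈ Set.Icc (-1 : ℝ) 1)
    (hy : innerObj s₀ a (meas a xstar Iout ξ) w y ≤
      ε + innerObj s₀ a (meas a xstar Iout ξ) w z) :
    m / 100 * ‖y - z‖ ≤ ε := by
  refine ha.norm_sub_le_of_sum_le hz0 hw (fun i hio hmis => ?_) (fun i => ?_) hy
  · rw [meas_eq_of_notMem hz hio]
    simp only [mismatch, Finset.mem_filter, Finset.mem_univ, true_and, not_le] at hmis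
    have hw0 : inner ℝ (a i) w ≠ 0 := by intro h; simp [h] at hmis
    rw [← sgn_mul_eq_abs (s₀ := s₀) hmis, ← mul_sub, sub_self, abs_zero, sub_zero, abs_mul,
      abs_sgn_eq_one s₀ hw0, one_mul, inner_sub_right]
  · have h1 := abs_sub_abs_le_abs_sub
      (sgn s₀ (inner ℝ (a i) w) * inner ℝ (a i) z - meas a xstar Iout ξ i)
      (sgn s₀ (inner ℝ (a i) w) * inner ℝ (a i) y - meas a xstar Iout ξ i)
    have h2 := mul_le_of_le_one_left (abs_nonneg (inner ℝ (a i) (y - z)))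
      (abs_sgn_le_one hs₀ (inner ℝ (a i) w))
    rw [sub_sub_sub_cancel_right, ← mul_sub, abs_mul, abs_sub_comm (inner ℝ (a i) z),
      ← inner_sub_right] at h1
    linarith

/-- Here the sign multiplies the data and cancels in the difference of residuals, so no bound on
`s₀` is needed. -/
lemma IsStable.norm_sub_le_of_exactObj_le (ha : IsStable a Iout)
    {w y z xstar : EuclideanSpace ℝ (Fin d)} (hz : z = xstar ∨ z = -xstar) (hz0 : z ≠ 0)
    (hw : ‖w - z‖ ≤ 2 / 25 * ‖z‖) {ξ : Fin m → ℝ} {s₀ ε : ℝ}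
    (hy : exactObj s₀ a (meas a xstar Iout ξ) w y ≤
      ε + exactObj s₀ a (meas a xstar Iout ξ) w z) :
    m / 100 * ‖y - z‖ ≤ ε := by
  refine ha.norm_sub_le_of_sum_le hz0 hw (fun i hio hmis => ?_) (fun i => ?_) hy
  · rw [meas_eq_of_notMem hz hio]
    simp only [mismatch, Finset.mem_filter, Finset.mem_univ, true_and, not_le] at hmis
    rw [sgn_mul_abs_eq hmis, sub_self, abs_zero, sub_zero, inner_sub_right]
  · have h1 := abs_sub_abs_le_abs_sub
      (inner ℝ (a i) z - sgn s₀ (inner ℝ (a i) w) * meas a xstar Iout ξ i)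
      (inner ℝ (a i) y - sgn s₀ (inner ℝ (a i) w) * meas a xstar Iout ξ i)
    rw [sub_sub_sub_cancel_right, abs_sub_comm (inner ℝ (a i) z) (inner ℝ (a i) y),
      ← inner_sub_right] at h1
    linarith

end

/-! ### Iteration, including the case of a zero signal. -/

section

variable {d m : ℕ}

lemma signDist_nonneg (x z : EuclideanSpace ℝ (Fin d)) : 0 ≤ signDist x z :=
  le_min (norm_nonneg _) (norm_nonneg _)

lemma signDist_zero_right (x : EuclideanSpace ℝ (Fin d)) : signDist x 0 = ‖x‖ := by
  simp [signDist]

lemma exists_signDist_eq (x z : EuclideanSpace ℝ (Fin d)) :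
    ∃ z', (z' = z ∨ z' = -z) ∧ signDist x z = ‖x - z'‖ := by
  rcases min_choice ‖x - z‖ ‖x + z‖ with h | h
  · exact ⟨z, Or.inl rfl, h⟩
  · exact ⟨-z, Or.inr rfl, by rw [sub_neg_eq_add]; exact h⟩

lemma signDist_le_of_eq_or_eq_neg {x z z' : EuclideanSpace ℝ (Fin d)} (h : z' = z ∨ z' = -z) :
    signDist x z ≤ ‖x - z'‖ := by
  rcases h with rfl | rfl
  · exact min_le_left _ _
  · rw [sub_neg_eq_add]; exact min_le_right _ _

variable {a : Fin m → EuclideanSpace ℝ (Fin d)} {Iout : Finset (Fin m)}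
  {xstar : EuclideanSpace ℝ (Fin d)} {ξ : Fin m → ℝ} {s₀ : ℝ} {w y : EuclideanSpace ℝ (Fin d)}

/-- One-step estimate common to the two inner problems, away from the origin. -/
lemma signDist_le_of_forall_norm_sub_le (hm : 1 ≤ m) {ε : ℝ} (hx : xstar ≠ 0)
    (hw : signDist w xstar ≤ Real.sin (2 / 25) * ‖xstar‖)
    (hstep : ∀ z, z = xstar ∨ z = -xstar → z ≠ 0 → ‖w - z‖ ≤ 2 / 25 * ‖z‖ →
      m / 100 * ‖y - z‖ ≤ ε) : signDist y xstar ≤ 100 * ε := by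
  obtain ⟨z, hz, hzd⟩ := exists_signDist_eq w xstar
  have hzn : ‖z‖ = ‖xstar‖ := by rcases hz with rfl | rfl <;> simp
  have hz0 : z ≠ 0 := by rwa [← norm_ne_zero_iff, hzn, norm_ne_zero_iff]
  have h1 : ‖w - z‖ ≤ 2 / 25 * ‖z‖ := by
    rw [← hzd, hzn]
    exact hw.trans (by gcongr; exact Real.sin_le (by norm_num))
  have h2 := hstep z hz hz0 h1
  have h3 : (1 : ℝ) ≤ m := by exact_mod_cast hm
  have h4 := signDist_le_of_eq_or_eq_neg (x := y) hz
  -- Since `1 ≤ m`, the factor `m / 100` may be weakened to `1 / 100`, the source of the constant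
  -- `100`.
  nlinarith [norm_nonneg (y - z)]

lemma IsStable.signDist_le_of_innerObj_le (ha : IsStable a Iout) (hm : 1 ≤ m) {ε : ℝ}
    (hx : xstar ≠ 0) (hs₀ : s₀ ∈ Set.Icc (-1 : ℝ) 1)
    (hw : signDist w xstar ≤ Real.sin (2 / 25) * ‖xstar‖)
    (hy : ∀ z, innerObj s₀ a (meas a xstar Iout ξ) w y ≤
      ε + innerObj s₀ a (meas a xstar Iout ξ) w z) : signDist y xstar ≤ 100 * ε :=
  signDist_le_of_forall_norm_sub_le hm hx hw fun z hz hz0 hwz =>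
    ha.norm_sub_le_of_innerObj_le hz hz0 hwz hs₀ (hy z)

lemma IsStable.signDist_le_of_exactObj_le (ha : IsStable a Iout) (hm : 1 ≤ m) {ε : ℝ}
    (hx : xstar ≠ 0) (hw : signDist w xstar ≤ Real.sin (2 / 25) * ‖xstar‖)
    (hy : ∀ z, exactObj s₀ a (meas a xstar Iout ξ) w y ≤
      ε + exactObj s₀ a (meas a xstar Iout ξ) w z) : signDist y xstar ≤ 100 * ε :=
  signDist_le_of_forall_norm_sub_le hm hx hw fun z hz hz0 hwz =>
    ha.norm_sub_le_of_exactObj_le hz hz0 hwz (hy z)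

/-- Serves `xstar = 0`, where the iterate is the origin and every sign is `s₀`: the data live on the
outliers, and plain `balance` suffices. The inexact form takes `c = s₀`, the exact one `c = 1`. -/
lemma IsStable.norm_le_of_sum_le (ha : IsStable a Iout) {b : Fin m → ℝ}
    (hb : ∀ i ∉ Iout, b i = 0) {c ε : ℝ}
    (hy : ∑ i, |c * inner ℝ (a i) y - b i| ≤ ε + ∑ i, |b i|) :
    |c| * (m / 100 * ‖y‖) ≤ ε := by
  have h1 := mul_le_mul_of_nonneg_left (ha.balance y) (abs_nonneg c)
  have h2 : |c| * ∑ i, outSign Iout i * |inner ℝ (a i) y| ≤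
      ∑ i, (|c * inner ℝ (a i) y - b i| - |b i|) := by
    rw [Finset.mul_sum]
    refine Finset.sum_le_sum fun i _ => ?_
    rw [mul_left_comm, ← abs_mul]
    unfold outSign
    split_ifs with hi
    · have := abs_sub_abs_le_abs_sub (b i) (b i - c * inner ℝ (a i) y)
      rw [sub_sub_cancel, abs_sub_comm] at this
      linarith
    · rw [hb i hi]; simp
  rw [Finset.sum_sub_distrib] at h2
  linarith

lemma meas_zero_of_notMem {i : Fin m} (hi : i ∉ Iout) : meas a 0 Iout ξ i = 0 := by
  simp [meas, hi]

lemma eq_zero_of_mul_norm_le_zero (hm : 1 ≤ m) {c : ℝ} (hc : c ≠ 0)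
    (h : |c| * (m / 100 * ‖y‖) ≤ 0) : y = 0 := by
  by_contra hy
  have h1 : 0 < ‖y‖ := norm_pos_iff.2 hy
  have h2 : (0 : ℝ) < m := by exact_mod_cast hm
  have : 0 < |c| * (m / 100 * ‖y‖) := by positivity
  linarith

lemma IsStable.eq_zero_of_innerObj_le (ha : IsStable a Iout) (hm : 1 ≤ m) {ε : ℝ} (hε : ε ≤ 0)
    (hs₀ : s₀ ≠ 0) (hy : innerObj s₀ a (meas a 0 Iout ξ) 0 y ≤
      ε + innerObj s₀ a (meas a 0 Iout ξ) 0 0) : y = 0 := by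
  refine eq_zero_of_mul_norm_le_zero hm hs₀ ((ha.norm_le_of_sum_le (ε := ε)
    (b := meas a 0 Iout ξ) (fun i => meas_zero_of_notMem) ?_).trans hε)
  simpa [innerObj, sgn] using hy

lemma IsStable.eq_zero_of_exactObj_le (ha : IsStable a Iout) (hm : 1 ≤ m)
    (hy : exactObj s₀ a (meas a 0 Iout ξ) 0 y ≤ exactObj s₀ a (meas a 0 Iout ξ) 0 0) :
    y = 0 := by
  refine eq_zero_of_mul_norm_le_zero hm one_ne_zero (ha.norm_le_of_sum_le (ε := 0) (c := 1)
    (b := fun i => s₀ * meas a 0 Iout ξ i) (fun i hi => by rw [meas_zero_of_notMem hi, mul_zero]) ?_)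
  simpa [exactObj, sgn] using hy

variable {x : ℕ → EuclideanSpace ℝ (Fin d)}

theorem IsStable.signDist_le_of_isInexactRobustAM (ha : IsStable a Iout) (hm : 1 ≤ m)
    (hs₀ : s₀ ∈ Set.Icc (-1 : ℝ) 1) {ε : ℕ → ℝ} (hbdd : BddAbove (Set.range ε))
    (hne : xstar ≠ 0 ∨ s₀ ≠ 0) (hx : IsInexactRobustAM s₀ a (meas a xstar Iout ξ) ε x)
    (h0 : max (signDist (x 0) xstar) (100 * ⨆ k, ε k) ≤ Real.sin (2 / 25) * ‖xstar‖) (k : ℕ) :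
    signDist (x k) xstar ≤ (1 / 2) ^ k * signDist (x 0) xstar + 100 * ⨆ k, ε k := by
  -- The iterate `x (k + 1)` is its own competitor.
  have hε0 : ∀ k, 0 ≤ ε k := fun k => by linarith [hx k (x (k + 1))]
  have hle : ∀ k, ε k ≤ ⨆ k, ε k := fun k => le_ciSup hbdd k
  have hsup : 0 ≤ ⨆ k, ε k := (hε0 0).trans (hle 0)
  obtain ⟨h0, hεs⟩ := max_le_iff.1 h0
  by_cases hxs : xstar = 0
  · subst hxs
    have hs : s₀ ≠ 0 := hne.resolve_left (not_not.2 rfl)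
    rw [norm_zero, mul_zero] at h0 hεs
    have hall : ∀ k, x k = 0 := by
      intro k
      induction k with
      | zero => rwa [signDist_zero_right, norm_le_zero_iff] at h0
      | succ k ih =>
        have h := hx k 0
        rw [ih] at h
        exact ha.eq_zero_of_innerObj_le hm (by linarith [hle k]) hs h
    rw [hall k, hall 0, signDist_zero_right, norm_zero]
    linarith
  · have hstep : ∀ k, signDist (x k) xstar ≤ Real.sin (2 / 25) * ‖xstar‖ →
        signDist (x (k + 1)) xstar ≤ 100 * ⨆ k, ε k := fun k hk =>
      (ha.signDist_le_of_innerObj_le hm hxs hs₀ hk (hx k)).trans (by gcongr; exact hle k)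
    have hbasin : ∀ k, signDist (x k) xstar ≤ Real.sin (2 / 25) * ‖xstar‖ := by
      intro k
      induction k with
      | zero => exact h0
      | succ k ih => exact (hstep k ih).trans hεs
    cases k with
    | zero => linarith
    | succ k =>
      have := signDist_nonneg (x 0) xstar
      exact (hstep k (hbasin k)).trans (le_add_of_nonneg_left (by positivity))

theorem IsStable.signDist_le_of_isRobustAM (ha : IsStable a Iout) (hm : 1 ≤ m)
    (hx : IsRobustAM s₀ a (meas a xstar Iout ξ) x)
    (h0 : signDist (x 0) xstar ≤ Real.sin (2 / 25) * ‖xstar‖) (k : ℕ) :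
    signDist (x k) xstar ≤ (1 / 2) ^ k * signDist (x 0) xstar := by
  have hx' : ∀ k z, exactObj s₀ a (meas a xstar Iout ξ) (x k) (x (k + 1)) ≤
      exactObj s₀ a (meas a xstar Iout ξ) (x k) z := fun k z => hx k (Set.mem_univ z)
  by_cases hxs : xstar = 0
  · subst hxs
    rw [norm_zero, mul_zero] at h0
    have hall : ∀ k, x k = 0 := by
      intro k
      induction k with
      | zero => rwa [signDist_zero_right, norm_le_zero_iff] at h0
      | succ k ih =>
        have h := hx' k 0
        rw [ih] at h
        exact ha.eq_zero_of_exactObj_le hm h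
    rw [hall k, hall 0, signDist_zero_right, norm_zero, mul_zero]
  · have hstep : ∀ k, signDist (x k) xstar ≤ Real.sin (2 / 25) * ‖xstar‖ →
        signDist (x (k + 1)) xstar ≤ 0 := fun k hk =>
      (ha.signDist_le_of_exactObj_le (ε := 0) hm hxs hk fun z => by
        rw [zero_add]; exact hx' k z).trans (by simp)
    have hsin : 0 ≤ Real.sin (2 / 25) * ‖xstar‖ := (signDist_nonneg _ _).trans h0
    have hbasin : ∀ k, signDist (x k) xstar ≤ Real.sin (2 / 25) * ‖xstar‖ := by
      intro k
      induction k with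
      | zero => exact h0
      | succ k ih => exact (hstep k ih).trans hsin
    have := signDist_nonneg (x 0) xstar
    cases k with
    | zero => simp
    | succ k => exact (hstep k (hbasin k)).trans (by positivity)

end

/-! ### Gaussian vectors are stable with high probability. -/

lemma sum_outSign {m : ℕ} (Iout : Finset (Fin m)) :
    ∑ i, outSign Iout i = m - 2 * (Iout.card : ℝ) := by
  have h : ∀ i, outSign Iout i = 1 - 2 * (if i ∈ Iout then 1 else 0) := by
    intro i; unfold outSign; split_ifs <;> norm_num
  simp_rw [h, Finset.sum_sub_distrib, ← Finset.mul_sum]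
  simp

lemma continuous_truncatedBalance (s : ℝ) : Continuous (truncatedBalance s) := by
  unfold truncatedBalance; fun_prop

lemma abs_truncatedBalance_le {s : ℝ} (hs : |s| = 1) (t : ℝ) : |truncatedBalance s t| ≤ 3 * |t| := by
  simpa [truncatedBalance] using abs_truncatedBalance_sub_le hs t 0

section

variable {d : ℕ}

lemma integral_truncatedBalance_inner (s : ℝ) {v : EuclideanSpace ℝ (Fin d)} (hv : ‖v‖ = 1) :
    ∫ a, truncatedBalance s (inner ℝ a v) ∂(stdGaussian (EuclideanSpace ℝ (Fin d))) =
      s * √(2 / Real.pi) - 2 * ∫ t, max (|t| - 2) 0 ∂(gaussianReal 0 1) := by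
  rw [integral_comp_inner_stdGaussian hv (continuous_truncatedBalance s)]
  unfold truncatedBalance
  rw [integral_sub (integrable_abs_gaussianReal.const_mul _)
    (integrable_posPart_abs_sub_two_gaussianReal.const_mul _), integral_const_mul,
    integral_const_mul, integral_abs_gaussianReal]

/-- The factor 3 covers both `|⟨a, v⟩|` and `truncatedBalance`, so that all net events share one
rate. -/
lemma integral_exp_abs_le_of_abs_le_mul_inner {f : EuclideanSpace ℝ (Fin d) → ℝ}
    (hf : Measurable f) {v : EuclideanSpace ℝ (Fin d)} (hv : ‖v‖ = 1)
    (hfv : ∀ a, |f a| ≤ 3 * |inner ℝ a v|) :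
    Integrable (fun a => Real.exp |f a|) (stdGaussian (EuclideanSpace ℝ (Fin d))) ∧
      ∫ a, Real.exp |f a| ∂(stdGaussian (EuclideanSpace ℝ (Fin d))) ≤
        2 * Real.exp (3 ^ 2 / 2) := by
  have h1 := integrable_comp_inner_stdGaussian hv (integrable_exp_mul_abs_gaussianReal 3)
  have h2 : Integrable (fun a => Real.exp |f a|) (stdGaussian (EuclideanSpace ℝ (Fin d))) := by
    refine h1.mono' (by fun_prop) (ae_of_all _ fun a => ?_)
    rw [Real.norm_eq_abs, Real.abs_exp]
    exact Real.exp_le_exp.2 (hfv a)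
  refine ⟨h2, (integral_mono h2 h1 fun a => Real.exp_le_exp.2 (hfv a)).trans ?_⟩
  rw [integral_comp_inner_stdGaussian hv (f := fun t => Real.exp (3 * |t|)) (by fun_prop)]
  exact integral_exp_mul_abs_gaussianReal_le 3

variable {m : ℕ} {Ω : Type*} [MeasurableSpace Ω] {P : Measure Ω} [IsProbabilityMeasure P]
  {a : Fin m → Ω → EuclideanSpace ℝ (Fin d)}

/-- The rate at which each of the net events fails. -/
noncomputable def netRate : ℝ := deviationRate (2 * Real.exp (3 ^ 2 / 2)) 0.005

lemma netRate_pos : 0 < netRate := deviationRate_pos (by positivity) (by norm_num)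

lemma measure_sum_comp_ge_le_exp (hind : iIndepFun a P)
    (hlaw : ∀ i, HasLaw (a i) (stdGaussian (EuclideanSpace ℝ (Fin d))) P)
    {f : Fin m → EuclideanSpace ℝ (Fin d) → ℝ} (hf : ∀ i, Measurable (f i))
    (hexp : ∀ i, Integrable (fun x => Real.exp |f i x|) (stdGaussian (EuclideanSpace ℝ (Fin d))) ∧
      ∫ x, Real.exp |f i x| ∂(stdGaussian (EuclideanSpace ℝ (Fin d))) ≤ 2 * Real.exp (3 ^ 2 / 2))
    {M : ℝ} (hM : ∑ i, ∫ x, f i x ∂(stdGaussian (EuclideanSpace ℝ (Fin d))) + 0.005 * m ≤ M) :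
    P.real {ω | M ≤ ∑ i, f i (a i ω)} ≤ Real.exp (-(netRate * m)) := by
  have hint : ∀ i, ∀ g : EuclideanSpace ℝ (Fin d) → ℝ, Measurable g →
      ∫ ω, g (a i ω) ∂P = ∫ x, g x ∂(stdGaussian (EuclideanSpace ℝ (Fin d))) :=
    fun i g hg => (hlaw i).integral_comp hg.aestronglyMeasurable
  refine measure_sum_ge_le_exp (X := fun i ω => f i (a i ω))
    (fun i => (hf i).comp_aemeasurable (hlaw i).aemeasurable) (hind.comp f hf) (by positivity)
    (by norm_num) (fun i => ?_) (fun i => ?_) ?_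
  · have := (hexp i).1
    rw [← (hlaw i).map_eq] at this
    exact this.comp_aemeasurable (hlaw i).aemeasurable
  · rw [hint i (fun x => Real.exp |f i x|) (by have := hf i; fun_prop)]
    exact (hexp i).2
  · simpa only [hint _ _ (hf _)] using hM

lemma measure_le_sum_abs_inner_le (hind : iIndepFun a P)
    (hlaw : ∀ i, HasLaw (a i) (stdGaussian (EuclideanSpace ℝ (Fin d))) P)
    {v : EuclideanSpace ℝ (Fin d)} (hv : ‖v‖ = 1) :
    P.real {ω | 0.9 * m ≤ ∑ i, |inner ℝ (a i ω) v|} ≤ Real.exp (-(netRate * m)) := by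
  refine measure_sum_comp_ge_le_exp hind hlaw (f := fun _ x => |inner ℝ x v|) (fun i => by fun_prop)
    (fun i => integral_exp_abs_le_of_abs_le_mul_inner (by fun_prop) hv fun x => ?_) ?_
  · rw [abs_abs]; linarith [abs_nonneg (inner ℝ x v)]
  · simp only [integral_abs_inner_stdGaussian, hv, Finset.sum_const, Finset.card_univ,
      Fintype.card_fin, nsmul_eq_mul, mul_one]
    have := sqrt_two_div_pi_lt
    have hm : (0 : ℝ) ≤ m := m.cast_nonneg
    nlinarith

lemma measure_sum_truncatedBalance_le_le (hind : iIndepFun a P)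
    (hlaw : ∀ i, HasLaw (a i) (stdGaussian (EuclideanSpace ℝ (Fin d))) P)
    {Iout : Finset (Fin m)} (hI : (Iout.card : ℝ) ≤ m / 4)
    {v : EuclideanSpace ℝ (Fin d)} (hv : ‖v‖ = 1) :
    P.real {ω | -(0.294 * m) ≤ ∑ i, -truncatedBalance (outSign Iout i) (inner ℝ (a i ω) v)} ≤
      Real.exp (-(netRate * m)) := by
  have hmeas : ∀ i, Measurable fun x : EuclideanSpace ℝ (Fin d) =>
      -truncatedBalance (outSign Iout i) (inner ℝ x v) := fun i =>
    ((continuous_truncatedBalance _).measurable.comp (by fun_prop)).neg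
  refine measure_sum_comp_ge_le_exp hind hlaw
    (f := fun i x => -truncatedBalance (outSign Iout i) (inner ℝ x v)) hmeas
    (fun i => integral_exp_abs_le_of_abs_le_mul_inner (hmeas i) hv fun x => ?_) ?_
  · rw [abs_neg]; exact abs_truncatedBalance_le (abs_outSign Iout i) _
  · simp only [integral_neg, integral_truncatedBalance_inner _ hv, Finset.sum_neg_distrib,
      Finset.sum_sub_distrib, ← Finset.sum_mul, sum_outSign, Finset.sum_const, Finset.card_univ,
      Fintype.card_fin, nsmul_eq_mul]
    -- Numerically `0.7978 / 2 - 2 * 0.0498 - 0.005 = 0.2943`.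
    have h1 := lt_sqrt_two_div_pi
    have h2 := integral_posPart_abs_sub_two_gaussianReal_le.trans exp_neg_three_lt.le
    have hm : (0 : ℝ) ≤ m := m.cast_nonneg
    have h3 : (m : ℝ) / 2 * 0.7978 ≤ (m - 2 * (Iout.card : ℝ)) * √(2 / Real.pi) := by
      have : (m : ℝ) / 2 ≤ m - 2 * (Iout.card : ℝ) := by linarith
      exact mul_le_mul this h1.le (by norm_num) (by linarith)
    have h4 := mul_le_mul_of_nonneg_left h2 hm
    linarith

lemma measure_le_card_filter_abs_inner_le (hind : iIndepFun a P)
    (hlaw : ∀ i, HasLaw (a i) (stdGaussian (EuclideanSpace ℝ (Fin d))) P)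
    {x u : EuclideanSpace ℝ (Fin d)} (hx : ‖x‖ = 1) (hu : ‖u‖ ≤ 2 / 25) :
    P.real {ω | 0.064 * (m : ℝ) ≤ ((Finset.univ.filter fun i =>
      |inner ℝ (a i ω) x| ≤ |inner ℝ (a i ω) u| + 0.004).card : ℝ)} ≤
      Real.exp (-(netRate * m)) := by
  set S : Set (EuclideanSpace ℝ (Fin d)) := {y | |inner ℝ y x| ≤ |inner ℝ y u| + 0.004} with hS
  have hSm : MeasurableSet S := measurableSet_le (by fun_prop) (by fun_prop)
  have hmeas : Measurable (S.indicator fun _ => (1 : ℝ)) := measurable_const.indicator hSm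
  have hle : ∀ y, |S.indicator (fun _ => (1 : ℝ)) y| ≤ 1 := fun y => by
    by_cases hy : y ∈ S <;> simp [hy]
  have hint : Integrable (fun y => Real.exp |S.indicator (fun _ => (1 : ℝ)) y|)
      (stdGaussian (EuclideanSpace ℝ (Fin d))) := by
    refine (integrable_const (Real.exp 1)).mono' (by fun_prop) (ae_of_all _ fun y => ?_)
    rw [Real.norm_eq_abs, Real.abs_exp]
    exact Real.exp_le_exp.2 (hle y)
  have h := measure_sum_comp_ge_le_exp hind hlaw (f := fun _ => S.indicator fun _ => (1 : ℝ))
    (M := 0.064 * m) (fun _ => hmeas) (fun _ => ⟨hint, ?_⟩) ?_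
  · refine le_of_eq_of_le ?_ h
    congr 1
    ext ω
    simp only [Set.mem_ofPred_eq, Set.indicator_apply, hS, Finset.sum_boole]
  · calc _ ≤ ∫ y, Real.exp 1 ∂(stdGaussian (EuclideanSpace ℝ (Fin d))) :=
          integral_mono hint (integrable_const _) fun y => Real.exp_le_exp.2 (hle y)
      _ = Real.exp 1 := by simp
      _ ≤ Real.exp (3 ^ 2 / 2) := Real.exp_le_exp.2 (by norm_num)
      _ ≤ _ := by linarith [Real.exp_pos (3 ^ 2 / 2)]
  · simp only [integral_indicator_const _ hSm, smul_eq_mul, mul_one, Finset.sum_const,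
      Finset.card_univ, Fintype.card_fin, nsmul_eq_mul]
    have h1 := mul_le_mul_of_nonneg_left (stdGaussian_abs_inner_le_add_le hx hu)
      (m.cast_nonneg (α := ℝ))
    rw [← hS] at h1
    linarith

/-- Gaussian ensembles are stable with overwhelming probability. -/
theorem measure_not_isStable_le (hd : 1 ≤ d) (hind : iIndepFun a P)
    (hlaw : ∀ i, HasLaw (a i) (stdGaussian (EuclideanSpace ℝ (Fin d))) P)
    {Iout : Finset (Fin m)} (hI : (Iout.card : ℝ) ≤ m / 4)
    (hm : (Real.log (3 * (1 + 2 / (1 / 1000000)) ^ 2) + 1) / netRate * d ≤ m) :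
    P.real {ω | ¬ IsStable (fun i => a i ω) Iout} ≤ Real.exp (-d) := by
  obtain ⟨N, hNS, hN, hNc⟩ := exists_finset_net (r := 1 / 1000000) (by norm_num)
    {x : EuclideanSpace ℝ (Fin d) | ‖x‖ = 1} fun x hx => le_of_eq hx
  obtain ⟨U, hUS, hU, hUc⟩ := exists_finset_net (r := 1 / 1000000) (by norm_num)
    {x : EuclideanSpace ℝ (Fin d) | ‖x‖ ≤ 2 / 25} fun x hx => le_trans hx (by norm_num)
  rw [finrank_euclideanSpace_fin] at hNc hUc
  set K : ℝ := 1 + 2 / (1 / 1000000) with hK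
  have hK1 : 1 ≤ K := by rw [hK]; norm_num
  set q := Real.exp (-(netRate * m)) with hq
  have hq0 : 0 ≤ q := (Real.exp_pos _).le
  let B₁ : EuclideanSpace ℝ (Fin d) → Set Ω := fun v => {ω | 0.9 * m ≤ ∑ i, |inner ℝ (a i ω) v|}
  let B₂ : EuclideanSpace ℝ (Fin d) → Set Ω := fun v =>
    {ω | -(0.294 * m) ≤ ∑ i, -truncatedBalance (outSign Iout i) (inner ℝ (a i ω) v)}
  let B₃ : EuclideanSpace ℝ (Fin d) × EuclideanSpace ℝ (Fin d) → Set Ω := fun p =>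
    {ω | 0.064 * (m : ℝ) ≤ ((Finset.univ.filter fun i =>
      |inner ℝ (a i ω) p.1| ≤ |inner ℝ (a i ω) p.2| + 0.004).card : ℝ)}
  have hsub : {ω | ¬ IsStable (fun i => a i ω) Iout} ⊆
      ((⋃ v ∈ N, B₁ v) ∪ ⋃ v ∈ N, B₂ v) ∪ ⋃ p ∈ N ×ˢ U, B₃ p := by
    intro ω hω
    by_contra hcon
    simp only [Set.mem_union, Set.mem_iUnion, not_or, not_exists, B₁, B₂, B₃,
      Set.mem_ofPred_eq, not_le, Finset.sum_neg_distrib, neg_lt_neg_iff, Finset.mem_product,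
      and_imp, Prod.forall] at hcon
    obtain ⟨⟨h1, h2⟩, h3⟩ := hcon
    exact hω (isStable_of_net (fun x hx => hN x hx) (fun u hu => hU u hu)
      (fun v hv => (h1 v hv).le) (fun v hv => (h2 v hv).le) fun x hx u hu => (h3 x u hx hu).le)
  have hunion : ∀ {ι : Type} (s : Finset ι) (B : ι → Set Ω), (∀ i ∈ s, P.real (B i) ≤ q) →
      P.real (⋃ i ∈ s, B i) ≤ s.card * q := by
    intro ι s B hB
    refine (measureReal_biUnion_finset_le s B).trans ((Finset.sum_le_sum hB).trans_eq ?_)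
    rw [Finset.sum_const, nsmul_eq_mul]
  have hb1 := hunion N B₁ fun v hv => measure_le_sum_abs_inner_le hind hlaw (hNS v hv)
  have hb2 := hunion N B₂ fun v hv => measure_sum_truncatedBalance_le_le hind hlaw hI (hNS v hv)
  have hb3 := hunion (N ×ˢ U) B₃ fun p hp => measure_le_card_filter_abs_inner_le hind hlaw
    (hNS _ (Finset.mem_product.1 hp).1) (hUS _ (Finset.mem_product.1 hp).2)
  rw [Finset.card_product, Nat.cast_mul] at hb3
  have hKd : 1 ≤ K ^ d := one_le_pow₀ hK1
  calc P.real {ω | ¬ IsStable (fun i => a i ω) Iout}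
      ≤ N.card * q + N.card * q + N.card * U.card * q :=
        (measureReal_mono hsub).trans ((measureReal_union_le _ _).trans (add_le_add
          ((measureReal_union_le _ _).trans (add_le_add hb1 hb2)) hb3))
    _ ≤ K ^ d * K ^ d * q + K ^ d * K ^ d * q + K ^ d * K ^ d * q := by
        have : (N.card : ℝ) ≤ K ^ d * K ^ d := hNc.trans (le_mul_of_one_le_right (by positivity) hKd)
        gcongr
    _ = 3 * (K ^ 2) ^ d * q := by rw [← pow_mul, two_mul, pow_add]; ring
    _ ≤ (3 * K ^ 2) ^ d * q := by
        rw [mul_pow]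
        gcongr
        -- Here `1 ≤ d` is needed, for `3 ≤ 3 ^ d`.
        exact le_self_pow₀ (by norm_num) (by omega)
    _ = Real.exp (d * Real.log (3 * K ^ 2) - netRate * m) := by
        rw [sub_eq_add_neg, Real.exp_add, Real.exp_nat_mul, Real.exp_log (by positivity)]
    _ ≤ Real.exp (-d) := by
        refine Real.exp_le_exp.2 ?_
        rw [div_mul_eq_mul_div, div_le_iff₀ netRate_pos] at hm
        linarith

end

end RobustPhaseRetrieval

/-! ### Assembly. -/

theorem theorem1 :
    ∃ C c : ℝ, 0 < C ∧ 0 < c ∧ ∃ ν lam : ℝ → ℝ,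
      ∀ η : ℝ, 0 ≤ η → η ≤ 1 / 4 →
        (0 < ν η ∧ ν η < 1 ∧ 0 < lam η) ∧
        ∀ (d m : ℕ), C * d ≤ m →
        ∀ Iout : Finset (Fin m), (Iout.card : ℝ) = η * m →
        ∀ {Ω : Type*} [MeasurableSpace Ω] (P : Measure Ω) [IsProbabilityMeasure P]
          (a : Fin m → Ω → EuclideanSpace ℝ (Fin d)),
          iIndepFun a P →
          (∀ i, HasLaw (a i) (stdGaussian (EuclideanSpace ℝ (Fin d))) P) →
          ∃ E : Set Ω, MeasurableSet E ∧ ENNReal.ofReal (1 - Real.exp (-(c * d))) ≤ P E ∧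
            ∀ ω ∈ E, ∀ (xstar : EuclideanSpace ℝ (Fin d)) (ξ : Fin m → ℝ),
            ∀ s₀ ∈ Set.Icc (-1 : ℝ) 1,
            ∀ x : ℕ → EuclideanSpace ℝ (Fin d),
              -- inexact inner solves
              (∀ ε : ℕ → ℝ, BddAbove (Set.range ε) →
                (xstar ≠ 0 ∨ s₀ ≠ 0) →
                IsInexactRobustAM s₀ (fun i => a i ω)
                  (meas (fun i => a i ω) xstar Iout ξ) ε x →
                max (signDist (x 0) xstar) (lam η * ⨆ k, ε k) ≤ Real.sin (2 / 25) * ‖xstar‖ →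
                ∀ k, signDist (x k) xstar ≤
                  ν η ^ k * signDist (x 0) xstar + lam η * ⨆ k, ε k) ∧
              -- exact inner solves
              (IsRobustAM s₀ (fun i => a i ω) (meas (fun i => a i ω) xstar Iout ξ) x →
                signDist (x 0) xstar ≤ Real.sin (2 / 25) * ‖xstar‖ →
                ∀ k, signDist (x k) xstar ≤ ν η ^ k * signDist (x 0) xstar) := by
  have hK : (0 : ℝ) < Real.log (3 * (1 + 2 / (1 / 1000000)) ^ 2) + 1 := by
    have := Real.log_nonneg (x := 3 * (1 + 2 / (1 / 1000000)) ^ 2) (by norm_num)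
    linarith
  refine ⟨_, 1, div_pos hK netRate_pos, one_pos, fun _ => 1 / 2, fun _ => 100,
    fun η hη0 hη => ⟨⟨by norm_num, by norm_num, by norm_num⟩, ?_⟩⟩
  intro d m hm Iout hI Ω _ P _ a hind hlaw
  rcases Nat.eq_zero_or_pos d with rfl | hd
  -- For `d = 0` the required probability is `0`.
  · exact ⟨∅, MeasurableSet.empty, by simp, fun ω hω => absurd hω (Set.notMem_empty ω)⟩
  have hm1 : 1 ≤ m := by
    have h1 : (0 : ℝ) < d := by exact_mod_cast hd
    have h2 := (mul_pos (div_pos hK netRate_pos) h1).trans_le hm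
    exact_mod_cast h2
  have hI' : (Iout.card : ℝ) ≤ m / 4 := by
    rw [hI]
    nlinarith [m.cast_nonneg (α := ℝ)]
  set B := {ω | ¬ IsStable (fun i => a i ω) Iout} with hB
  have hPB : P.real B ≤ Real.exp (-d) := measure_not_isStable_le hd hind hlaw hI' hm
  -- Passing to a measurable hull of equal measure avoids proving `B` measurable.
  refine ⟨(toMeasurable P B)ᶜ, (measurableSet_toMeasurable P B).compl, ?_, fun ω hω => ?_⟩
  · rw [ENNReal.ofReal_le_iff_le_toReal (measure_ne_top _ _), ← measureReal_def,
      probReal_compl_eq_one_sub (measurableSet_toMeasurable P B), measureReal_def,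
      measure_toMeasurable, ← measureReal_def, one_mul]
    linarith
  · have hst : IsStable (fun i => a i ω) Iout := by
      by_contra hns
      exact hω (subset_toMeasurable P B hns)
    intro xstar ξ s₀ hs₀ x
    exact ⟨fun ε hbdd hne hx h0 k =>
        hst.signDist_le_of_isInexactRobustAM hm1 hs₀ hbdd hne hx h0 k,
      fun hx h0 k => hst.signDist_le_of_isRobustAM hm1 hx h0 k⟩
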